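/- Let $m,\ell$ be nonnegative integers, and let $\mathbb S_m^{++}$ be the set of real symmetric positive definite $m\times m$ matrices. For a real symmetric $m\times m$ matrix $M$ with eigenvalues $\lambda_1,\dots,\lambda_m$ (counted with multiplicity), let $$E_\ell(M)=\sum_{I\subseteq\{1,\dots,m\},\ |I|=\ell}\ \prod_{j\in I}\lambda_j$$ (so $E_0=1$ as an empty product, and $E_\ell=0$ for $\ell>m$). For $P,Q\in\mathbb S_m^{++}$ and $t\in[0,1]$, let $$P\#_tQ=P^{1/2}\bigl(P^{-1/2}QP^{-1/2}\bigr)^tP^{1/2}\in\mathbb S_m^{++}$$ be the weighted matrix geometric mean. Then $E_\ell$ is geodesically log-convex on $\mathbb S_m^{++}$: for all $P,Q\in\mathbb S_m^{++}$ and all $t\in[0,1]$, $$E_\ell(P\#_tQ)\le E_\ell(P)^{1-t}\,E_\ell(Q)^{t},$$ with the convention $0^0=1$. Moreover, if $1\le\ell\le m$, then $E_\ell>0$ on $\mathbb S_m^{++}$ and $\log E_\ell$ is geodesically convex: for all such $P,Q,t$, $$\log E_\ell(P\#_tQ)\le(1-t)\log E_\ell(P)+t\log E_\ell(Q).$$ 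-/

import Mathlib

open scoped MatrixOrder

/-- The `ℓ`-th elementary symmetric polynomial of a vector `v ∈ ℝᵐ`: the sum over all `ℓ`-element
index sets `I` of `∏_{j ∈ I} v_j`. It vanishes for `ℓ > m`. -/
noncomputable def vecESP {m : ℕ} (ℓ : ℕ) (v : Fin m → ℝ) : ℝ :=
  ∑ I ∈ (Finset.univ : Finset (Fin m)).powersetCard ℓ, ∏ j ∈ I, v j

/-- The set of real (symmetric) positive definite `m × m` matrices. -/
abbrev PDMatrix (m : ℕ) : Type := {P : Matrix (Fin m) (Fin m) ℝ // P.PosDef}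

/-- `E_ℓ(M)`: the `ℓ`-th elementary symmetric polynomial of the eigenvalues (with multiplicity)
of a real symmetric matrix `M`. -/
noncomputable def matrixESP {m : ℕ} (ℓ : ℕ) {M : Matrix (Fin m) (Fin m) ℝ}
    (hM : M.IsHermitian) : ℝ :=
  vecESP ℓ hM.eigenvalues

/-- `E_ℓ` as a function on positive definite matrices. -/
noncomputable def pdESP {m : ℕ} (ℓ : ℕ) (P : PDMatrix m) : ℝ :=
  matrixESP ℓ P.2.isHermitian

/-- The matrix `P^{1/2} (P^{-1/2} Q P^{-1/2})^t P^{1/2}`; real powers are those of the (spectral)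
functional calculus. -/
noncomputable def geoMeanMatrix {m : ℕ} (t : ℝ) (P Q : Matrix (Fin m) (Fin m) ℝ) :
    Matrix (Fin m) (Fin m) ℝ :=
  P ^ (1 / 2 : ℝ) * (P ^ (-(1 / 2) : ℝ) * Q * P ^ (-(1 / 2) : ℝ)) ^ t * P ^ (1 / 2 : ℝ)

theorem posDef_rpow {m : ℕ} {P : Matrix (Fin m) (Fin m) ℝ} (hP : P.PosDef) (s : ℝ) :
    (P ^ s).PosDef := by
  rw [← Matrix.isStrictlyPositive_iff_posDef] at hP ⊢
  exact IsStrictlyPositive.rpow P s hP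

theorem posDef_conj {m : ℕ} {A B : Matrix (Fin m) (Fin m) ℝ} (hA : A.PosDef) (hB : B.PosDef) :
    (A * B * A).PosDef := by
  have h := hB.conjTranspose_mul_mul_same (B := A)
    (Matrix.mulVec_injective_iff_isUnit.2 hA.isUnit)
  rwa [hA.isHermitian.eq] at h

theorem posDef_geoMeanMatrix {m : ℕ} (t : ℝ) {P Q : Matrix (Fin m) (Fin m) ℝ}
    (hP : P.PosDef) (hQ : Q.PosDef) : (geoMeanMatrix t P Q).PosDef :=
  posDef_conj (posDef_rpow hP _) (posDef_rpow (posDef_conj (posDef_rpow hP _) hQ) t)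

/-- The weighted geometric mean `P #_t Q`, a positive definite matrix: the point with parameter `t`
on the geodesic from `P` to `Q` for the metric `g_P(X, Y) = tr (P⁻¹ X P⁻¹ Y)`. -/
noncomputable def geoMean {m : ℕ} (t : ℝ) (P Q : PDMatrix m) : PDMatrix m :=
  ⟨geoMeanMatrix t P.1 Q.1, posDef_geoMeanMatrix t P.2 Q.2⟩

/-- Geodesic convexity of a function on the positive definite matrices. -/
def GeodesicallyConvex {m : ℕ} (f : PDMatrix m → ℝ) : Prop :=
  ∀ P Q : PDMatrix m, ∀ t ∈ Set.Icc (0 : ℝ) 1,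
    f (geoMean t P Q) ≤ (1 - t) * f P + t * f Q

/-- Geodesic log-convexity in multiplicative form (meant for nonnegative functions). -/
def GeodesicallyLogConvex {m : ℕ} (f : PDMatrix m → ℝ) : Prop :=
  ∀ P Q : PDMatrix m, ∀ t ∈ Set.Icc (0 : ℝ) 1,
    f (geoMean t P Q) ≤ f P ^ (1 - t) * f Q ^ t

/-!
Write `C = P^{-1/2} Q P^{-1/2} = U diag(d) Uᵀ` and `X = P^{1/2} U`. Then the whole geodesic is
diagonalized by one congruence: `P #_t Q = X diag(d^t) Xᵀ`, with `P` at `t = 0` and `Q` at `t = 1`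
(`exists_geoMeanMatrix_eq`).

`E_ℓ(M)` is, up to sign, a coefficient of the characteristic polynomial of `M`, hence the sum of
the principal `ℓ`-minors of any matrix with the same characteristic polynomial. For
`M = X diag(v) Xᵀ` such a matrix is `diag(v) (Xᵀ X)`, so that
`E_ℓ(X diag(v) Xᵀ) = ∑_I w_I ∏_{i ∈ I} v_i`, where the weights `w_I`, the principal minors of the
Gram matrix `Xᵀ X`, are nonnegative and do not depend on `v` (`matrixESP_conj_diagonal`).

Along the geodesic this reads `E_ℓ(P #_t Q) = ∑_I w_I (∏_{i ∈ I} d_i)^t`, and such a function of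
`t` is log-convex by Hölder's inequality (`sum_mul_rpow_le`).
-/

theorem vecESP_nonneg {m : ℕ} (ℓ : ℕ) {v : Fin m → ℝ} (hv : ∀ i, 0 < v i) : 0 ≤ vecESP ℓ v :=
  Finset.sum_nonneg fun _ _ => Finset.prod_nonneg fun i _ => (hv i).le

theorem vecESP_pos {m ℓ : ℕ} (h : ℓ ≤ m) {v : Fin m → ℝ} (hv : ∀ i, 0 < v i) :
    0 < vecESP ℓ v :=
  Finset.sum_pos (fun _ _ => Finset.prod_pos fun i _ => hv i)
    (Finset.powersetCard_nonempty.2 (by simpa using h))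

theorem vecESP_eq_zero {m ℓ : ℕ} (h : m < ℓ) (v : Fin m → ℝ) : vecESP ℓ v = 0 := by
  rw [vecESP, Finset.powersetCard_eq_empty.2 (by simpa using h), Finset.sum_empty]

theorem pdESP_nonneg {m : ℕ} (ℓ : ℕ) (P : PDMatrix m) : 0 ≤ pdESP ℓ P :=
  vecESP_nonneg ℓ P.2.eigenvalues_pos

theorem pdESP_pos {m ℓ : ℕ} (h : ℓ ≤ m) (P : PDMatrix m) : 0 < pdESP ℓ P :=
  vecESP_pos h P.2.eigenvalues_pos

theorem pdESP_eq_zero {m ℓ : ℕ} (h : m < ℓ) (P : PDMatrix m) : pdESP ℓ P = 0 :=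
  vecESP_eq_zero h _

theorem sum_minors_eq_of_charpoly_eq {m : ℕ} (ℓ : ℕ) {M N : Matrix (Fin m) (Fin m) ℝ}
    (h : M.charpoly = N.charpoly) :
    ∑ s ∈ (Finset.univ : Finset (Fin m)).powersetCard ℓ,
        (M.submatrix (Subtype.val : s → Fin m) (Subtype.val : s → Fin m)).det =
      ∑ s ∈ (Finset.univ : Finset (Fin m)).powersetCard ℓ,
        (N.submatrix (Subtype.val : s → Fin m) (Subtype.val : s → Fin m)).det := by
  rcases le_or_gt ℓ m with hl | hl
  · have hl' : ℓ ≤ Fintype.card (Fin m) := by simpa using hl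
    have hM := M.charpoly_coeff_eq_sum_minors ℓ hl'
    rw [h, N.charpoly_coeff_eq_sum_minors ℓ hl'] at hM
    exact (mul_left_cancel₀ (pow_ne_zero _ (by norm_num)) hM).symm
  · rw [Finset.powersetCard_eq_empty.2 (by simpa using hl), Finset.sum_empty, Finset.sum_empty]

theorem det_submatrix_diagonal_mul {m : ℕ} (v : Fin m → ℝ) (G : Matrix (Fin m) (Fin m) ℝ)
    (s : Finset (Fin m)) :
    ((Matrix.diagonal v * G).submatrix (Subtype.val : s → Fin m) (Subtype.val : s → Fin m)).det =
      (∏ i ∈ s, v i) *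
        (G.submatrix (Subtype.val : s → Fin m) (Subtype.val : s → Fin m)).det := by
  have h : (Matrix.diagonal v * G).submatrix (Subtype.val : s → Fin m) (Subtype.val : s → Fin m) =
      Matrix.diagonal (fun i : s => v i) *
        G.submatrix (Subtype.val : s → Fin m) (Subtype.val : s → Fin m) := by
    ext i j
    simp [Matrix.diagonal_mul]
  rw [h, Matrix.det_mul, Matrix.det_diagonal, Finset.prod_coe_sort s v]

theorem matrixESP_eq_sum_minors {m : ℕ} (ℓ : ℕ) {M N : Matrix (Fin m) (Fin m) ℝ}
    (hM : M.IsHermitian) (h : M.charpoly = N.charpoly) :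
    matrixESP ℓ hM = ∑ s ∈ (Finset.univ : Finset (Fin m)).powersetCard ℓ,
      (N.submatrix (Subtype.val : s → Fin m) (Subtype.val : s → Fin m)).det := by
  have hd : (Matrix.diagonal hM.eigenvalues * 1).charpoly = N.charpoly := by
    rw [mul_one, Matrix.charpoly_diagonal, ← h, hM.charpoly_eq]
    rfl
  rw [← sum_minors_eq_of_charpoly_eq ℓ hd, matrixESP, vecESP]
  refine Finset.sum_congr rfl fun s _ => ?_
  rw [det_submatrix_diagonal_mul, Matrix.submatrix_one _ Subtype.val_injective, Matrix.det_one,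
    mul_one]

/-- A Cauchy–Binet type expansion: under a congruence by `X`, `E_ℓ` of a diagonal matrix becomes a
weighted elementary symmetric polynomial of the diagonal, whose weights are the principal minors of
the Gram matrix `Xᵀ X`. -/
theorem matrixESP_conj_diagonal {m : ℕ} (ℓ : ℕ) {M X : Matrix (Fin m) (Fin m) ℝ}
    {v : Fin m → ℝ} (hM : M.IsHermitian) (h : M = X * Matrix.diagonal v * X.transpose) :
    matrixESP ℓ hM = ∑ s ∈ (Finset.univ : Finset (Fin m)).powersetCard ℓ,
      ((X.transpose * X).submatrix (Subtype.val : s → Fin m) (Subtype.val : s → Fin m)).det *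
        ∏ i ∈ s, v i := by
  have hc : M.charpoly = (Matrix.diagonal v * (X.transpose * X)).charpoly := by
    rw [h, mul_assoc, Matrix.charpoly_mul_comm, mul_assoc]
  rw [matrixESP_eq_sum_minors ℓ hM hc]
  refine Finset.sum_congr rfl fun s _ => ?_
  rw [det_submatrix_diagonal_mul, mul_comm]

theorem geoMeanMatrix_zero {m : ℕ} {P Q : Matrix (Fin m) (Fin m) ℝ}
    (hP : P.PosDef) (hQ : Q.PosDef) : geoMeanMatrix 0 P Q = P := by
  have hC := posDef_conj (posDef_rpow hP (-(1 / 2))) hQ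
  rw [geoMeanMatrix, CFC.rpow_zero _ hC.posSemidef.nonneg, mul_one, ← CFC.rpow_add hP.isUnit,
    add_halves, CFC.rpow_one P hP.posSemidef.nonneg]

theorem geoMeanMatrix_one {m : ℕ} {P Q : Matrix (Fin m) (Fin m) ℝ}
    (hP : P.PosDef) (hQ : Q.PosDef) : geoMeanMatrix 1 P Q = Q := by
  have hC := posDef_conj (posDef_rpow hP (-(1 / 2))) hQ
  have h1 : P ^ (1 / 2 : ℝ) * P ^ (-(1 / 2) : ℝ) = 1 := by
    rw [← CFC.rpow_add hP.isUnit, add_neg_cancel, CFC.rpow_zero P hP.posSemidef.nonneg]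
  have h2 : P ^ (-(1 / 2) : ℝ) * P ^ (1 / 2 : ℝ) = 1 := by
    rw [← CFC.rpow_add hP.isUnit, neg_add_cancel, CFC.rpow_zero P hP.posSemidef.nonneg]
  rw [geoMeanMatrix, CFC.rpow_one _ hC.posSemidef.nonneg]
  calc _ = (P ^ (1 / 2 : ℝ) * P ^ (-(1 / 2) : ℝ)) * Q * (P ^ (-(1 / 2) : ℝ) * P ^ (1 / 2 : ℝ)) := by
        simp only [mul_assoc]
    _ = Q := by rw [h1, h2, one_mul, mul_one]

theorem rpow_eq_eigenvectorUnitary_conj {m : ℕ} {C : Matrix (Fin m) (Fin m) ℝ} (hC : C.PosDef)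
    (t : ℝ) :
    C ^ t = (hC.isHermitian.eigenvectorUnitary : Matrix (Fin m) (Fin m) ℝ) *
      Matrix.diagonal (fun i => hC.isHermitian.eigenvalues i ^ t) *
      (hC.isHermitian.eigenvectorUnitary : Matrix (Fin m) (Fin m) ℝ).transpose := by
  rw [CFC.rpow_eq_cfc_real hC.posSemidef.nonneg, hC.isHermitian.cfc_eq,
    Matrix.IsHermitian.cfc, Unitary.conjStarAlgAut_apply,
    Matrix.star_eq_conjTranspose, Matrix.conjTranspose_eq_transpose_of_trivial]
  rfl

/-- One congruence diagonalizes all points of the geodesic through `P` and `Q`. -/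
theorem exists_geoMeanMatrix_eq {m : ℕ} {P Q : Matrix (Fin m) (Fin m) ℝ}
    (hP : P.PosDef) (hQ : Q.PosDef) :
    ∃ (X : Matrix (Fin m) (Fin m) ℝ) (d : Fin m → ℝ), (∀ i, 0 < d i) ∧
      ∀ t : ℝ, geoMeanMatrix t P Q =
        X * Matrix.diagonal (fun i => d i ^ t) * X.transpose := by
  have hC := posDef_conj (posDef_rpow hP (-(1 / 2))) hQ
  have hA : (P ^ (1 / 2 : ℝ)).transpose = P ^ (1 / 2 : ℝ) := by
    simpa [Matrix.conjTranspose_eq_transpose_of_trivial] using (posDef_rpow hP (1 / 2)).1.eq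
  refine ⟨P ^ (1 / 2 : ℝ) * (hC.isHermitian.eigenvectorUnitary : Matrix (Fin m) (Fin m) ℝ),
    hC.isHermitian.eigenvalues, hC.eigenvalues_pos, fun t => ?_⟩
  rw [geoMeanMatrix, rpow_eq_eigenvectorUnitary_conj hC, Matrix.transpose_mul, hA]
  simp only [mul_assoc]

/-- Hölder's inequality with exponents `1 / (1 - t)` and `1 / t`, for the functions `1` and `x` on a
weighted finite set; the endpoints `t = 0` and `t = 1` are included. -/
theorem sum_mul_rpow_le {ι : Type*} (s : Finset ι) (w x : ι → ℝ) {t : ℝ}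
    (ht : t ∈ Set.Icc (0 : ℝ) 1) (hw : ∀ i ∈ s, 0 ≤ w i) (hx : ∀ i ∈ s, 0 ≤ x i)
    (h0 : 0 < ∑ i ∈ s, w i) (h1 : 0 < ∑ i ∈ s, w i * x i) :
    ∑ i ∈ s, w i * x i ^ t ≤ (∑ i ∈ s, w i) ^ (1 - t) * (∑ i ∈ s, w i * x i) ^ t := by
  obtain ⟨ht0, ht1⟩ := ht
  set a := ∑ i ∈ s, w i with ha
  set b := ∑ i ∈ s, w i * x i with hb
  have hab : 0 < a ^ (1 - t) * b ^ t := by positivity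
  -- Termwise weighted AM-GM for `w i / a` and `w i * x i / b`, both of total mass one.
  have key : ∀ i ∈ s, w i * x i ^ t ≤
      (a ^ (1 - t) * b ^ t) * ((1 - t) * (w i / a) + t * (w i * x i / b)) := by
    intro i hi
    have hwi := hw i hi
    have hxi := hx i hi
    have h := Real.geom_mean_le_arith_mean2_weighted (sub_nonneg.2 ht1) ht0
      (div_nonneg hwi h0.le) (div_nonneg (mul_nonneg hwi hxi) h1.le) (sub_add_cancel 1 t)
    refine le_trans (le_of_eq ?_) (mul_le_mul_of_nonneg_left h hab.le)
    have hww : w i ^ (1 - t) * w i ^ t = w i := by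
      rw [← Real.rpow_add_of_nonneg hwi (sub_nonneg.2 ht1) ht0, sub_add_cancel, Real.rpow_one]
    rw [Real.div_rpow hwi h0.le, Real.div_rpow (mul_nonneg hwi hxi) h1.le,
      Real.mul_rpow hwi hxi]
    have ha' : a ^ (1 - t) ≠ 0 := by positivity
    have hb' : b ^ t ≠ 0 := by positivity
    field_simp
    rw [mul_assoc, hww, mul_comm]
  refine (Finset.sum_le_sum key).trans (le_of_eq ?_)
  rw [← Finset.mul_sum, Finset.sum_add_distrib, ← Finset.mul_sum, ← Finset.mul_sum,
    ← Finset.sum_div, ← Finset.sum_div, ← ha, ← hb, div_self h0.ne', div_self h1.ne']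
  ring

theorem pdESP_geoMean_le {m ℓ : ℕ} (hl : ℓ ≤ m) (P Q : PDMatrix m) {t : ℝ}
    (ht : t ∈ Set.Icc (0 : ℝ) 1) :
    pdESP ℓ (geoMean t P Q) ≤ pdESP ℓ P ^ (1 - t) * pdESP ℓ Q ^ t := by
  obtain ⟨X, d, hd, hX⟩ := exists_geoMeanMatrix_eq P.2 Q.2
  set w : Finset (Fin m) → ℝ := fun s =>
    ((X.transpose * X).submatrix (Subtype.val : s → Fin m) (Subtype.val : s → Fin m)).det with hw
  have hw0 : ∀ s, 0 ≤ w s := fun s => by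
    have hG : (X.transpose * X).PosSemidef := by
      simpa [Matrix.conjTranspose_eq_transpose_of_trivial] using
        Matrix.posSemidef_conjTranspose_mul_self X
    exact (hG.submatrix _).det_nonneg
  have hE : ∀ (u : ℝ) (R : PDMatrix m), R.1 = geoMeanMatrix u P.1 Q.1 →
      pdESP ℓ R = ∑ s ∈ (Finset.univ : Finset (Fin m)).powersetCard ℓ,
        w s * (∏ i ∈ s, d i) ^ u := by
    intro u R hR
    rw [pdESP, matrixESP_conj_diagonal ℓ R.2.isHermitian (hR.trans (hX u))]
    refine Finset.sum_congr rfl fun s _ => ?_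
    rw [Real.finsetProd_rpow _ _ fun i _ => (hd i).le]
  have hEP := hE 0 P (geoMeanMatrix_zero P.2 Q.2).symm
  have hEQ := hE 1 Q (geoMeanMatrix_one P.2 Q.2).symm
  simp only [Real.rpow_zero, mul_one] at hEP
  simp only [Real.rpow_one] at hEQ
  rw [hE t (geoMean t P Q) rfl, hEP, hEQ]
  exact sum_mul_rpow_le _ w _ ht (fun s _ => hw0 s)
    (fun s _ => Finset.prod_nonneg fun i _ => (hd i).le)
    (hEP ▸ pdESP_pos hl P) (hEQ ▸ pdESP_pos hl Q)

theorem lemma1 (m ℓ : ℕ) :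
    GeodesicallyLogConvex (fun P : PDMatrix m => pdESP ℓ P) ∧
      (1 ≤ ℓ → ℓ ≤ m →
        (∀ P : PDMatrix m, 0 < pdESP ℓ P) ∧
          GeodesicallyConvex (fun P : PDMatrix m => Real.log (pdESP ℓ P))) := by
  refine ⟨fun P Q t ht => ?_, fun _ hl => ⟨pdESP_pos hl, fun P Q t ht => ?_⟩⟩
  · rcases le_or_gt ℓ m with hl | hl
    · exact pdESP_geoMean_le hl P Q ht
    · change pdESP ℓ (geoMean t P Q) ≤ pdESP ℓ P ^ (1 - t) * pdESP ℓ Q ^ t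
      rw [pdESP_eq_zero hl (geoMean t P Q)]
      exact mul_nonneg (Real.rpow_nonneg (pdESP_nonneg ℓ P) _)
        (Real.rpow_nonneg (pdESP_nonneg ℓ Q) _)
  · have hP := pdESP_pos hl P
    have hQ := pdESP_pos hl Q
    have h := Real.log_le_log (pdESP_pos hl _) (pdESP_geoMean_le hl P Q ht)
    rwa [Real.log_mul (Real.rpow_pos_of_pos hP _).ne' (Real.rpow_pos_of_pos hQ _).ne',
      Real.log_rpow hP, Real.log_rpow hQ] at h
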